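/- Let $M$ be a universal prefix-free machine, that is, a partial computable map $M :\subseteq \{0,1\}^* \to \{0,1\}^*$ with prefix-free domain such that for every partial computable $N :\subseteq \{0,1\}^* \to \{0,1\}^*$ with prefix-free domain there is a constant $c$ such that every output $N(s)$ equals $M(t)$ for some $t$ with $|t| \le |s| + c$. Let $K(w)$ be the length of a shortest $t$ with $M(t) = w$ (prefix-free Kolmogorov complexity). Let $\mathrm{MLR} \subseteq \{0,1\}^{\mathbb N}$ be the set of Martin-Löf random sequences, i.e. of those $p$ that lie outside $\bigcap_i V_i$ for every computable sequence $(V_i)_{i \in \mathbb N}$ of open sets with $\lambda(V_i) \le 2^{-i}$, where $\lambda$ is the uniform measure on $\{0,1\}^{\mathbb N}$. Write $p_{\le n}$ for the prefix of $p$ of length $n$. Then for every $p \in \mathrm{MLR}$ there is some $c \in \mathbb N$ with $K(p_{\le n}) \ge n - c$ for all $n \in \mathbb N$, so that $$\mathrm{Kol} : \mathrm{MLR} \to \mathbb N, \qquad \mathrm{Kol}(p) = \min\{c \in \mathbb N \mid \forall n \in \mathbb N \;\; K(p_{\le n}) \ge n - c\}$$ is well defined, and $$\mathrm{Kol} \equiv_{\mathrm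 W} \mathrm C_{\mathbb N} \times d_{\mathrm{MLR}} .$$ Here $\mathrm C_{\mathbb N} :\subseteq \mathcal A(\mathbb N) \rightrightarrows \mathbb N$ is closed choice on $\mathbb N$: its input is a nonempty set $A \subseteq \mathbb N$, named by any $p \in \mathbb N^{\mathbb N}$ with $n \notin A \Leftrightarrow \exists i\; p(i) = n + 1$, and every $n \in A$ is a correct output. The map $d_{\mathrm{MLR}} : \mathrm{MLR} \to \{1\}$ is the unique map of that type, where $\mathrm{MLR}$ is seen as a subspace of $\{0,1\}^{\mathbb N} \subseteq \mathbb N^{\mathbb N}$. For partial multivalued functions $f, g$ between represented spaces, $f \times g$ is the product, computed componentwise on pairs of inputs; $f \le_{\mathrm W} g$ means that there are computable $P, H :\subseteq \mathbb N^{\mathbb N} \to \mathbb N^{\mathbb N}$ such that $p \mapsto P\langle p, G(H(p)) \rangle$ realizes $f$ for every realizer $G$ of $g$; and $f \equiv_{\mathrm W} g$ means $f \le_{\mathrm W} g$ and $g \le_{\mathrm W} f$. -/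

import Mathlib

namespace Weihrauch

/-! ### Computable functions on Baire space -/

/-- The prefix `p 0, …, p (n - 1)` of length `n` of an infinite sequence. -/
def prefixOf {α : Type*} (p : ℕ → α) (n : ℕ) : List α := (List.range n).map p

/-- A partial function `F :⊆ ℕ^ℕ → ℕ^ℕ` is computable (by a Type-2 machine) if there is an
algorithm `a` such that the `n`-th entry of the output on input `p` is found by reading longer and
longer prefixes `w` of `p` until `a (n, w)` returns a value; `F p` is defined exactly when this
succeeds for every `n`. -/
def ComputableFun (F : (ℕ → ℕ) →. (ℕ → ℕ)) : Prop :=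
  ∃ a : ℕ × List ℕ → Option ℕ, Computable a ∧
    ∀ p q, q ∈ F p ↔ ∀ n, q n ∈ Nat.rfindOpt fun k => a (n, prefixOf p k)

/-- The standard pairing on Baire space, by interleaving. -/
def pair (p q : ℕ → ℕ) : ℕ → ℕ := fun n => if n % 2 = 0 then p (n / 2) else q (n / 2)

theorem pair_even (p q : ℕ → ℕ) : (fun n => pair p q (2 * n)) = p := by
  funext n
  simp [pair]

theorem pair_odd (p q : ℕ → ℕ) : (fun n => pair p q (2 * n + 1)) = q := by
  funext n
  have h : (2 * n + 1) / 2 = n := by omega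
  simp [pair, h]

/-! ### Represented spaces -/

/-- A represented space: a set with a partial surjection from Baire space. -/
class RepresentedSpace (X : Type*) where
  /-- the representation -/
  rep : (ℕ → ℕ) →. X
  rep_surjective : ∀ x, ∃ p, x ∈ rep p

open RepresentedSpace

/-- Baire space, represented by the identity. -/
instance instBaire : RepresentedSpace (ℕ → ℕ) where
  rep p := Part.some p
  rep_surjective x := ⟨x, Part.mem_some x⟩

/-- The natural numbers: `p` is a name for `p 0`. -/
instance instNat : RepresentedSpace ℕ where
  rep p := Part.some (p 0)
  rep_surjective n := ⟨fun _ => n, Part.mem_some n⟩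

/-- The inclusion of Cantor space into Baire space. -/
def toBaire (x : ℕ → Bool) : ℕ → ℕ := fun n => (x n).toNat

/-- Cantor space, represented as the subspace of `0`-`1`-sequences of Baire space. -/
instance instCantor : RepresentedSpace (ℕ → Bool) where
  rep p := ⟨∀ n, p n ≤ 1, fun _ n => decide (p n = 1)⟩
  rep_surjective x := by
    refine ⟨toBaire x, fun n => Bool.toNat_le (x n), ?_⟩
    funext n
    cases h : x n <;> simp [toBaire, h]

/-- A subset of a represented space, with the restricted representation. -/
instance instSubset {X : Type*} [RepresentedSpace X] (A : Set X) : RepresentedSpace A where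
  rep p := ⟨∃ h : (rep (X := X) p).Dom, (rep (X := X) p).get h ∈ A, fun h => ⟨_, h.snd⟩⟩
  rep_surjective x := by
    obtain ⟨p, h, hx⟩ := rep_surjective x.1
    exact ⟨p, ⟨h, hx ▸ x.2⟩, Subtype.ext hx⟩

/-- The product of two represented spaces: `⟨p, q⟩` names `(x, y)` if `p` names `x` and
`q` names `y`. -/
instance instProd {X Y : Type*} [RepresentedSpace X] [RepresentedSpace Y] : RepresentedSpace (X × Y) where
  rep r :=
    ⟨(rep (X := X) fun n => r (2 * n)).Dom ∧ (rep (X := Y) fun n => r (2 * n + 1)).Dom,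
      fun h => ((rep (X := X) fun n => r (2 * n)).get h.1,
        (rep (X := Y) fun n => r (2 * n + 1)).get h.2)⟩
  rep_surjective x := by
    obtain ⟨p, hp⟩ := rep_surjective x.1
    obtain ⟨q, hq⟩ := rep_surjective x.2
    rw [← pair_even p q] at hp
    rw [← pair_odd p q] at hq
    obtain ⟨h₁, e₁⟩ := hp
    obtain ⟨h₂, e₂⟩ := hq
    exact ⟨pair p q, ⟨h₁, h₂⟩, Prod.ext e₁ e₂⟩

/-- The points of the hyperspace `𝒜(ℕ)` of closed subsets of `ℕ` (all subsets are closed). -/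
@[ext] structure ClosedSubsets where
  /-- the underlying set -/
  carrier : Set ℕ

/-- `p` is a name for `A ∈ 𝒜(ℕ)` if it enumerates the complement of `A`:
`n ∉ A ↔ ∃ i, p i = n + 1`. -/
instance instClosedSubsets : RepresentedSpace ClosedSubsets where
  rep p := Part.some ⟨{n : ℕ | ¬ ∃ i, p i = n + 1}⟩
  rep_surjective A := by
    classical
    refine ⟨fun i => if i ∈ A.carrier then 0 else i + 1, ?_⟩
    rw [Part.mem_some_iff]
    ext n
    constructor
    · rintro hn ⟨i, hi⟩
      dsimp only at hi
      split_ifs at hi with h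
      exact h (Nat.succ_injective hi ▸ hn)
    · intro h
      by_contra hn
      exact h ⟨n, if_neg hn⟩

/-! ### Weihrauch reducibility -/

/-- A partial multivalued function `f :⊆ X ⇉ Y`; its domain is `{x | (f x).Nonempty}`. -/
abbrev Multi (X Y : Type*) := X → Set Y

section

variable {X Y Z W : Type*} [RepresentedSpace X] [RepresentedSpace Y] [RepresentedSpace Z]
  [RepresentedSpace W]

/-- `F ⊢ f`: the partial function `F` on Baire space maps every name of a point `x` of the domain
of `f` to a name of a point of `f x`. -/
def Realizes (F : (ℕ → ℕ) →. (ℕ → ℕ)) (f : Multi X Y) : Prop :=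
  ∀ p, ∀ x ∈ rep (X := X) p, (f x).Nonempty → ∃ q ∈ F p, ∃ y ∈ rep (X := Y) q, y ∈ f x

/-- Weihrauch reducibility `f ≤_W g`: there are computable `K, H :⊆ ℕ^ℕ → ℕ^ℕ` such that
`p ↦ K⟨p, G (H p)⟩` realizes `f` whenever `G` realizes `g`. -/
def Reducible (f : Multi X Y) (g : Multi Z W) : Prop :=
  ∃ K H : (ℕ → ℕ) →. (ℕ → ℕ), ComputableFun K ∧ ComputableFun H ∧
    ∀ G : (ℕ → ℕ) →. (ℕ → ℕ), Realizes G g →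
      Realizes (fun p => (H p).bind fun r => (G r).bind fun s => K (pair p s)) f

/-- Weihrauch equivalence `f ≡_W g`. -/
def Equivalent (f : Multi X Y) (g : Multi Z W) : Prop :=
  Reducible f g ∧ Reducible g f

end

/-- The product `f × g` of multivalued functions. -/
def multiProd {X Y Z W : Type*} (f : Multi X Y) (g : Multi Z W) : Multi (X × Z) (Y × W) :=
  fun x => f x.1 ×ˢ g x.2

/-- Closed choice `C_ℕ :⊆ 𝒜(ℕ) ⇉ ℕ`, with `n ∈ C_ℕ(A)` iff `n ∈ A`. -/
def closedChoiceNat : Multi ClosedSubsets ℕ := fun A => A.carrier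

/-- For `A ⊆ ℕ^ℕ`, the unique map `d_A : A → {1}`. -/
def constOn (A : Set (ℕ → ℕ)) : Multi A ({1} : Set ℕ) := fun _ => {⟨1, rfl⟩}

/-! ### Martin-Löf randomness -/

/-- The uniform (Lebesgue) measure on Cantor space. -/
noncomputable def cantorMeasure : MeasureTheory.Measure (ℕ → Bool) :=
  MeasureTheory.Measure.infinitePi fun _ => (PMF.uniformOfFintype Bool).toMeasure

/-- The sequence `(U i)` of open subsets of Cantor space is computable: an algorithm lists, given
`i`, finitely or infinitely many words `w` such that `U i` is the union of the cylinders of the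
`w`. -/
def ComputableOpenSeq (U : ℕ → Set (ℕ → Bool)) : Prop :=
  ∃ g : ℕ → ℕ → Option (List Bool), Computable₂ g ∧
    ∀ i, U i = {p | ∃ j, ∃ w ∈ g i j, prefixOf p w.length = w}

/-- Martin-Löf tests. -/
def IsMLTest (U : ℕ → Set (ℕ → Bool)) : Prop :=
  ComputableOpenSeq U ∧ ∀ i, cantorMeasure (U i) ≤ (2 ^ i : ENNReal)⁻¹

/-- Universal Martin-Löf tests. -/
def IsUniversalMLTest (U : ℕ → Set (ℕ → Bool)) : Prop :=
  IsMLTest U ∧ ∀ V, IsMLTest V → ⋂ i, V i ⊆ ⋂ i, U i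

/-- The set of Martin-Löf random sequences: those which pass every Martin-Löf test. -/
def MLR : Set (ℕ → Bool) := {p | ∀ V, IsMLTest V → p ∉ ⋂ i, V i}

/-- `MLR` is the complement of `⋂ i, U i` for every universal Martin-Löf test `U`. -/
theorem MLR_eq {U : ℕ → Set (ℕ → Bool)} (hU : IsUniversalMLTest U) : MLR = (⋂ i, U i)ᶜ :=
  Set.ext fun _ => ⟨fun h => h U hU.1, fun h V hV hp => h (hU.2 V hV hp)⟩

/-! ### Prefix-free Kolmogorov complexity -/

/-- A prefix-free machine: a partial computable function on words with prefix-free domain. -/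
def IsPrefixFreeMachine (M : List Bool →. List Bool) : Prop :=
  Partrec M ∧ ∀ s t, (M s).Dom → (M t).Dom → s <+: t → s = t

/-- A universal prefix-free machine: a prefix-free machine that produces every output of any other
prefix-free machine from programs that are longer by at most a constant. -/
def IsUniversalPrefixFreeMachine (M : List Bool →. List Bool) : Prop :=
  IsPrefixFreeMachine M ∧ ∀ N, IsPrefixFreeMachine N →
    ∃ c : ℕ, ∀ s, ∀ w ∈ N s, ∃ t, w ∈ M t ∧ t.length ≤ s.length + c

/-- The complexity `K(w)` with respect to `M`: the length of a shortest program for `w`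
(`⊤` if there is none). -/
noncomputable def complexity (M : List Bool →. List Bool) (w : List Bool) : ℕ∞ :=
  ⨅ s, ⨅ _ : w ∈ M s, (s.length : ℕ∞)

/-- The set of all `c` with `K(p_{≤ n}) ≥ n - c` for all `n`. -/
def deficiencyBounds (M : List Bool →. List Bool) (p : ℕ → Bool) : Set ℕ :=
  {c | ∀ n : ℕ, (n : ℕ∞) ≤ complexity M (prefixOf p n) + c}

/-- The map `Kol : MLR → ℕ` sending `p` to the least `c` with `K(p_{≤ n}) ≥ n - c` for all `n`. -/
def Kol (M : List Bool →. List Bool) : Multi MLR ℕ :=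
  fun p => {c | IsLeast (deficiencyBounds M p) c}

end Weihrauch

open Weihrauch

open scoped ENNReal

namespace Weihrauch

/-! ### Prefixes of sequences -/

/-! `Kol` is well defined because the sequences with a prefix `w` that some program shorter than
`|w| - c` produces form a Martin-Löf test in `c`: each program `t` contributes at most one cylinder,
of measure below `2 ^ (-|t| - c)`, and Kraft's inequality sums these
(`exists_mem_deficiencyBounds`).

For `Kol ≤ C_ℕ × d_MLR`, enumerate the graph of `M`. The value `Kol p` is the maximum of the gains
`|w| - |t|`, truncated at zero, over the listed pairs `(t, w)` with `w` a prefix of `p`. Being the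
maximum is refutable, but being attained is not, so a position `e` at which the maximum `c` is
attained is guessed along with it: the complement of the set of all such `⟨c, e⟩` can be enumerated
from `p`. Closed choice finds such a pair, and `p` itself is the input for `d_MLR`
(`reducible_Kol`).

For the converse, let `r` name `A` and let `p` be random. Guess the elements `0, 1, 2, …` in turn,
moving on when `r` refutes the guess, and meanwhile copy `p` to the output. At a refutation in stage
`s`, append `2 * k` zeros, where `k` codes the current word together with `s + c + 1`, and start `p`
anew. As `A` is nonempty, this happens finitely often, so the output has tail `p` and is random
(`exists_padSeq_shift`, `mem_MLR_of_shift`). The padded word has length at least `2 * k` but a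
program of length at most `k + 1 + c`, with `c` the constant from universality, so the deficiency of
the output is at least `s` (`le_of_refuted`). Hence the value of `Kol` on the output bounds every
stage with a refutation, and the guess after that many stages is final and correct
(`Kol_reducible`). -/

@[simp] theorem length_prefixOf {α : Type*} (p : ℕ → α) (n : ℕ) : (prefixOf p n).length = n := by
  simp [prefixOf]

theorem prefixOf_succ {α : Type*} (p : ℕ → α) (n : ℕ) :
    prefixOf p (n + 1) = prefixOf p n ++ [p n] := by
  simp [prefixOf, List.range_succ]

theorem prefixOf_succ' {α : Type*} (p : ℕ → α) (n : ℕ) :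
    prefixOf p (n + 1) = p 0 :: prefixOf (fun i => p (i + 1)) n := by
  simp [prefixOf, List.range_succ_eq_map, Function.comp_def]

theorem getD_prefixOf {α : Type*} (p : ℕ → α) {n i : ℕ} (h : i < n) (d : α) :
    (prefixOf p n).getD i d = p i := by
  simp [prefixOf, h]

theorem take_prefixOf {α : Type*} (p : ℕ → α) {m n : ℕ} (h : m ≤ n) :
    (prefixOf p n).take m = prefixOf p m := by
  simp [prefixOf, ← List.map_take, List.take_range, h]

theorem map_prefixOf {α β : Type*} (f : α → β) (p : ℕ → α) (n : ℕ) :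
    (prefixOf p n).map f = prefixOf (fun i => f (p i)) n := by
  simp [prefixOf]

theorem prefixOf_eq_iff {α : Type*} (p : ℕ → α) (w : List α) :
    prefixOf p w.length = w ↔ ∀ i (h : i < w.length), p i = w[i] := by
  constructor
  · intro h i hi
    have := getD_prefixOf p hi (p 0)
    rw [h] at this
    rw [← this, List.getD_eq_getElem _ _ hi]
  · intro h
    refine List.ext_getElem (by simp) fun i h₁ h₂ => ?_
    simp [prefixOf, h i h₂]

/-! ### The uniform measure of cylinders -/

/-- The set of all sequences with prefix `w`. -/
def cylinder (w : List Bool) : Set (ℕ → Bool) := {p | prefixOf p w.length = w}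

theorem cylinder_eq_pi (w : List Bool) :
    cylinder w = Set.pi (Finset.range w.length) fun i => {w.getD i false} := by
  ext p
  simp only [cylinder, Set.mem_ofPred_eq, prefixOf_eq_iff, Set.mem_pi, Finset.coe_range,
    Set.mem_Iio, Set.mem_singleton_iff]
  refine forall₂_congr fun i hi => ?_
  rw [List.getD_eq_getElem _ _ hi]

theorem measurableSet_cylinder (w : List Bool) : MeasurableSet (cylinder w) := by
  rw [cylinder_eq_pi]
  exact MeasurableSet.pi (Finset.countable_toSet _) fun _ _ => MeasurableSet.of_discrete

theorem uniform_singleton (b : Bool) :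
    (PMF.uniformOfFintype Bool).toMeasure {b} = (2 : ℝ≥0∞)⁻¹ := by
  rw [PMF.toMeasure_apply_singleton _ _ (MeasurableSet.singleton b)]
  simp

theorem cantorMeasure_cylinder (w : List Bool) :
    cantorMeasure (cylinder w) = (2 ^ w.length : ℝ≥0∞)⁻¹ := by
  rw [cylinder_eq_pi, cantorMeasure, MeasureTheory.Measure.infinitePi_pi _
    fun _ _ => MeasurableSet.of_discrete]
  simp only [uniform_singleton, Finset.prod_const, Finset.card_range, ENNReal.inv_pow]

instance : MeasureTheory.IsProbabilityMeasure cantorMeasure := by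
  unfold cantorMeasure; infer_instance

theorem disjoint_cylinder {s t : List Bool} (h₁ : ¬ s <+: t) (h₂ : ¬ t <+: s) :
    Disjoint (cylinder s) (cylinder t) := by
  rw [Set.disjoint_left]
  intro p (hs : _ = _) (ht : _ = _)
  rcases le_total s.length t.length with h | h
  · refine h₁ ?_
    rw [← hs, ← ht, ← take_prefixOf p h]
    exact List.take_prefix _ _
  · refine h₂ ?_
    rw [← hs, ← ht, ← take_prefixOf p h]
    exact List.take_prefix _ _

/-- Kraft's inequality. -/
theorem tsum_prefixFree_le_one {D : Set (List Bool)}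
    (hD : ∀ s ∈ D, ∀ t ∈ D, s <+: t → s = t) :
    ∑' t : D, (2 ^ (t : List Bool).length : ℝ≥0∞)⁻¹ ≤ 1 := by
  calc ∑' t : D, (2 ^ (t : List Bool).length : ℝ≥0∞)⁻¹
      = ∑' t : D, cantorMeasure (cylinder t) := by simp only [cantorMeasure_cylinder]
    _ = cantorMeasure (⋃ t : D, cylinder t) := by
        refine (MeasureTheory.measure_iUnion (fun s t hst => ?_)
          fun t => measurableSet_cylinder _).symm
        exact disjoint_cylinder (fun h => hst (Subtype.ext (hD _ s.2 _ t.2 h)))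
          fun h => hst (Subtype.ext (hD _ t.2 _ s.2 h).symm)
    _ ≤ 1 := MeasureTheory.prob_le_one

/-! ### Prepending a bit -/

/-- The sequence `p` with `b` put in front. -/
def consSeq (b : Bool) (p : ℕ → Bool) : ℕ → Bool
  | 0 => b
  | n + 1 => p n

theorem measurable_consSeq : Measurable fun x : Bool × (ℕ → Bool) => consSeq x.1 x.2 := by
  refine measurable_pi_lambda _ fun n => ?_
  cases n with
  | zero => exact measurable_fst
  | succ n => exact (measurable_pi_apply n).comp measurable_snd

theorem map_consSeq :
    ((PMF.uniformOfFintype Bool).toMeasure.prod cantorMeasure).map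
      (fun x => consSeq x.1 x.2) = cantorMeasure := by
  refine MeasureTheory.Measure.eq_infinitePi _ fun s t ht => ?_
  -- Enlarging the index set to an initial segment, with trivial factors `Set.univ`, lets coordinate
  -- `0` be split off.
  obtain ⟨n, hn⟩ : ∃ n, s ⊆ Finset.range (n + 1) :=
    ⟨s.sup id, fun i hi => Finset.mem_range.2 (Nat.lt_succ_of_le (Finset.le_sup (f := id) hi))⟩
  classical
  set u : ℕ → Set Bool := fun i => if i ∈ s then t i else Set.univ with hu
  have h₁ : Set.pi (s : Set ℕ) t = Set.pi (Finset.range (n + 1)) u := by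
    ext p
    simp only [Set.mem_pi, Finset.mem_coe, hu]
    constructor
    · intro h i _
      split_ifs with hi
      · exact h i hi
      · trivial
    · intro h i hi
      simpa [hi] using h i (hn hi)
  have h₂ : ∏ i ∈ s, (PMF.uniformOfFintype Bool).toMeasure (t i) =
      ∏ i ∈ Finset.range (n + 1), (PMF.uniformOfFintype Bool).toMeasure (u i) := by
    rw [← Finset.prod_subset hn]
    · exact Finset.prod_congr rfl fun i hi => by simp [hu, hi]
    · intro i _ hi
      simp only [hu, if_neg hi, MeasureTheory.measure_univ]
  have h₃ : (fun x : Bool × (ℕ → Bool) => consSeq x.1 x.2) ⁻¹' Set.pi (Finset.range (n + 1)) u =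
      u 0 ×ˢ Set.pi (Finset.range n) fun i => u (i + 1) := by
    ext ⟨b, p⟩
    simp only [Set.mem_preimage, Set.mem_pi, Finset.coe_range, Set.mem_Iio, Set.mem_prod]
    constructor
    · exact fun h => ⟨h 0 (Nat.succ_pos _), fun i hi => h (i + 1) (Nat.succ_lt_succ hi)⟩
    · rintro ⟨h, h'⟩ (_ | i) hi
      · exact h
      · exact h' i (Nat.lt_of_succ_lt_succ hi)
  rw [h₁, h₂, MeasureTheory.Measure.map_apply measurable_consSeq, h₃,
    MeasureTheory.Measure.prod_prod, cantorMeasure, MeasureTheory.Measure.infinitePi_pi _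
    fun _ _ => MeasurableSet.of_discrete, Finset.prod_range_succ', mul_comm]
  exact MeasurableSet.pi (Finset.countable_toSet _) fun _ _ => MeasurableSet.of_discrete

/-- By `map_consSeq` the first bit is an independent fair coin, and the event that it equals `b`
already contributes half the measure of the preimage to `V`. -/
theorem cantorMeasure_consSeq_preimage_le (b : Bool) {V : Set (ℕ → Bool)} (hV : MeasurableSet V) :
    cantorMeasure (consSeq b ⁻¹' V) ≤ 2 * cantorMeasure V := by
  have h : (2 : ℝ≥0∞)⁻¹ * cantorMeasure (consSeq b ⁻¹' V) ≤ cantorMeasure V := by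
    conv_rhs => rw [← map_consSeq, MeasureTheory.Measure.map_apply measurable_consSeq hV]
    rw [← uniform_singleton b, ← MeasureTheory.Measure.prod_prod]
    refine MeasureTheory.measure_mono ?_
    rintro ⟨b', p⟩ ⟨rfl, hp⟩
    exact hp
  rwa [mul_comm, ← ENNReal.div_eq_inv_mul.trans (mul_comm _ _),
    ENNReal.div_le_iff two_ne_zero ENNReal.ofNat_ne_top, mul_comm] at h

/-- The residual of `u` after the bit `b`: the cylinder of `u` consists of the sequences `consSeq b p`
with `p` in the cylinder of the residual. -/
def residual (b : Bool) : List Bool → Option (List Bool)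
  | [] => some []
  | a :: u => if a = b then some u else none

theorem computable_residual (b : Bool) : Computable (residual b) := by
  have : Primrec fun l : List Bool => (List.casesOn l (some []) fun a u =>
      if a = b then some u else none : Option (List Bool)) :=
    Primrec.list_casesOn Primrec.id (Primrec.const _) <|
      (Primrec.ite (Primrec.eq.comp (Primrec.fst.comp Primrec.snd) (Primrec.const b))
        (Primrec.option_some.comp (Primrec.snd.comp Primrec.snd)) (Primrec.const none)).to₂
  exact (this.of_eq fun l => by cases l <;> rfl).to_comp

theorem consSeq_mem_cylinder {b : Bool} {p : ℕ → Bool} {u : List Bool} :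
    prefixOf (consSeq b p) u.length = u ↔
      ∃ w ∈ residual b u, prefixOf p w.length = w := by
  cases u with
  | nil => simp [residual, prefixOf]
  | cons a u =>
    by_cases hab : a = b
    · subst hab
      simp [residual, prefixOf_succ', consSeq]
    · simp [residual, prefixOf_succ', consSeq, hab, Ne.symm hab]

theorem ComputableOpenSeq.measurableSet {U : ℕ → Set (ℕ → Bool)} (hU : ComputableOpenSeq U)
    (i : ℕ) : MeasurableSet (U i) := by
  obtain ⟨g, -, hg⟩ := hU
  have : U i = ⋃ j, ⋃ w ∈ {w | w ∈ g i j}, cylinder w := by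
    rw [hg i]
    ext p
    simp [cylinder]
  rw [this]
  exact MeasurableSet.iUnion fun j => MeasurableSet.biUnion (Set.to_countable _)
    fun w _ => measurableSet_cylinder w

/-- The index shift `i + 1` pays for the factor `2` lost by removing the first bit. -/
theorem IsMLTest.consSeq_preimage {V : ℕ → Set (ℕ → Bool)} (hV : IsMLTest V) (b : Bool) :
    IsMLTest fun i => consSeq b ⁻¹' V (i + 1) := by
  refine ⟨?_, fun i => ?_⟩
  · obtain ⟨g, hg, hVg⟩ := hV.1
    refine ⟨fun i j => (g (i + 1) j).bind (residual b), ?_, fun i => ?_⟩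
    · exact Computable.option_bind
        (hg.comp (Computable.succ.comp Computable.fst) Computable.snd)
        ((computable_residual b).comp Computable.snd)
    · ext p
      simp only [hVg, Set.mem_preimage, Set.mem_ofPred_eq, consSeq_mem_cylinder,
        Option.mem_def, Option.bind_eq_some_iff]
      refine exists_congr fun j => ?_
      constructor
      · rintro ⟨u, hu, w, hw, hp⟩
        exact ⟨w, ⟨u, hu, hw⟩, hp⟩
      · rintro ⟨w, ⟨u, hu, hw⟩, hp⟩
        exact ⟨u, hu, w, hw, hp⟩
  · refine (cantorMeasure_consSeq_preimage_le b (hV.1.measurableSet _)).trans ?_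
    calc 2 * cantorMeasure (V (i + 1)) ≤ 2 * (2 ^ (i + 1) : ℝ≥0∞)⁻¹ := by
          gcongr; exact hV.2 _
      _ = (2 ^ i : ℝ≥0∞)⁻¹ := by
          rw [pow_succ, ENNReal.mul_inv (by simp) (by simp), mul_comm, mul_assoc,
            ENNReal.inv_mul_cancel two_ne_zero ENNReal.ofNat_ne_top, mul_one]

theorem mem_MLR_of_tail {q : ℕ → Bool} (h : (fun n => q (n + 1)) ∈ MLR) : q ∈ MLR := by
  intro V hV hq
  refine h _ (hV.consSeq_preimage (q 0)) ?_
  rw [Set.mem_iInter] at hq ⊢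
  intro i
  have : consSeq (q 0) (fun n => q (n + 1)) = q := by
    funext n; cases n <;> rfl
  rw [Set.mem_preimage, this]
  exact hq (i + 1)

/-- Martin-Löf randomness does not depend on a finite prefix. -/
theorem mem_MLR_of_shift {p : ℕ → Bool} (hp : p ∈ MLR) (m : ℕ) {q : ℕ → Bool}
    (h : ∀ n, q (n + m) = p n) : q ∈ MLR := by
  induction m generalizing q with
  | zero => exact (funext h : q = p) ▸ hp
  | succ m ih => exact mem_MLR_of_tail (ih fun n => h n)

/-! ### Enumerating the graph of a machine -/

/-- `E` enumerates the graph of `M`, and it lists no pair `(t, w)` before stage `|w|`. -/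
structure EnumeratesGraph (E : ℕ → Option (List Bool × List Bool))
    (M : List Bool →. List Bool) : Prop where
  primrec : Primrec E
  length_le : ∀ {e t w}, E e = some (t, w) → w.length ≤ e
  mem_iff : ∀ {t w}, w ∈ M t ↔ ∃ e, E e = some (t, w)

theorem exists_enumeratesGraph {M : List Bool →. List Bool} (hM : Partrec M) :
    ∃ E, EnumeratesGraph E M := by
  obtain ⟨c, hc⟩ := Nat.Partrec.Code.exists_code.1 hM
  have hmem : ∀ {t w}, w ∈ M t ↔ ∃ k, Encodable.encode w ∈ c.evaln k (Encodable.encode t) := by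
    intro t w
    rw [← Nat.Partrec.Code.evaln_complete, hc]
    simp
  let E : ℕ → Option (List Bool × List Bool) := fun e =>
    (c.evaln e.unpair.1 e.unpair.2).bind fun v =>
      (Encodable.decode v : Option (List Bool)).bind fun w =>
        (Encodable.decode e.unpair.2 : Option (List Bool)).bind fun t =>
          if w.length ≤ e then some (t, w) else none
  have hE : Primrec E := by
    refine Primrec.option_bind
      (Nat.Partrec.Code.primrec_evaln.comp
        (((Primrec.fst.comp Primrec.unpair).pair (Primrec.const c)).pair
          (Primrec.snd.comp Primrec.unpair))) ?_
    refine Primrec.option_bind (Primrec.decode.comp Primrec.snd) ?_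
    refine Primrec.option_bind (Primrec.decode.comp (Primrec.snd.comp (Primrec.unpair.comp
      (Primrec.fst.comp Primrec.fst)))) ?_
    exact Primrec.ite (Primrec.nat_le.comp (Primrec.list_length.comp
        (Primrec.snd.comp Primrec.fst)) (Primrec.fst.comp (Primrec.fst.comp Primrec.fst)))
      (Primrec.option_some.comp (Primrec.snd.pair (Primrec.snd.comp Primrec.fst)))
      (Primrec.const none)
  have hEs : ∀ {e t w}, E e = some (t, w) ↔ ∃ v ∈ c.evaln e.unpair.1 e.unpair.2,
      Encodable.decode v = some w ∧ Encodable.decode e.unpair.2 = some t ∧ w.length ≤ e := by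
    intro e t w
    simp only [E, Option.bind_eq_some_iff, Option.mem_def]
    constructor
    · rintro ⟨v, hv, w', hw', t', ht', h⟩
      split_ifs at h with hl
      cases h
      exact ⟨v, hv, hw', ht', hl⟩
    · rintro ⟨v, hv, hw, ht, hl⟩
      exact ⟨v, hv, w, hw, t, ht, if_pos hl⟩
  refine ⟨E, hE, fun h => ?_, ?_⟩
  · obtain ⟨v, -, -, -, hl⟩ := hEs.1 h
    exact hl
  · intro t w
    constructor
    · intro h
      obtain ⟨k, hk⟩ := hmem.1 h
      -- The step bound is raised to at least `|w|`, so that the length filter in `E` does not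
      -- discard the pair; `evaln` is monotone in this bound.
      refine ⟨Nat.pair (max k w.length) (Encodable.encode t), hEs.2 ⟨Encodable.encode w, ?_, ?_⟩⟩
      · simpa using Nat.Partrec.Code.evaln_mono (le_max_left _ _) hk
      · simpa using (le_max_right k w.length).trans (Nat.left_le_pair _ _)
    · rintro ⟨e, he⟩
      obtain ⟨v, hv, hw, ht, -⟩ := hEs.1 he
      have hv' := Nat.Partrec.Code.evaln_sound hv
      obtain ⟨w', hw', rfl⟩ : ∃ w', w' ∈ M t ∧ Encodable.encode w' = v := by
        simpa [hc, ht] using hv'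
      rw [Encodable.encodek] at hw
      cases hw
      exact hw'

/-! ### Deficiency bounds -/

/-- Moving `c` to the left by truncated subtraction turns a bound on the infimum `K` into one
condition per program. -/
theorem mem_deficiencyBounds_iff {M : List Bool →. List Bool} {p : ℕ → Bool} {c : ℕ} :
    c ∈ deficiencyBounds M p ↔
      ∀ t w, w ∈ M t → prefixOf p w.length = w → w.length ≤ t.length + c := by
  have h₀ : ∀ n a b : ℕ, ((n : ℕ∞) - (b : ℕ∞) ≤ (a : ℕ∞)) ↔ n ≤ a + b := fun n a b => by
    rw [tsub_le_iff_right]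
    exact_mod_cast Iff.rfl
  simp only [deficiencyBounds, complexity, Set.mem_ofPred_eq, ← tsub_le_iff_right, le_iInf_iff, h₀]
  constructor
  · exact fun h t w hw hp => h w.length t (hp.symm ▸ hw)
  · intro h n t ht
    simpa using h t _ ht (by rw [length_prefixOf])

theorem exists_mem_deficiencyBounds {M : List Bool →. List Bool} (hM : IsPrefixFreeMachine M)
    {p : ℕ → Bool} (hp : p ∈ MLR) : ∃ c, c ∈ deficiencyBounds M p := by
  obtain ⟨E, hE⟩ := exists_enumeratesGraph hM.1
  let V : ℕ → Set (ℕ → Bool) := fun c =>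
    {p | ∃ t w, w ∈ M t ∧ t.length + c < w.length ∧ prefixOf p w.length = w}
  have hV : IsMLTest V := by
    refine ⟨⟨fun c e => (E e).bind fun x =>
      if x.1.length + c < x.2.length then some x.2 else none, ?_, fun c => ?_⟩, fun c => ?_⟩
    · refine Primrec.to_comp (Primrec.option_bind (hE.primrec.comp Primrec.snd) ?_)
      exact Primrec.ite
        (Primrec.nat_lt.comp
          (Primrec.nat_add.comp (Primrec.list_length.comp (Primrec.fst.comp Primrec.snd))
            (Primrec.fst.comp Primrec.fst))
          (Primrec.list_length.comp (Primrec.snd.comp Primrec.snd)))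
        (Primrec.option_some.comp (Primrec.snd.comp Primrec.snd)) (Primrec.const none)
    · ext q
      simp only [V, Set.mem_ofPred_eq, hE.mem_iff, Option.mem_def, Option.bind_eq_some_iff]
      constructor
      · rintro ⟨t, w, ⟨e, he⟩, hl, hq⟩
        exact ⟨e, w, ⟨(t, w), he, if_pos hl⟩, hq⟩
      · rintro ⟨e, w', ⟨⟨t, w⟩, he, hw⟩, hq⟩
        split_ifs at hw with hl
        cases hw
        exact ⟨t, w, ⟨e, he⟩, hl, hq⟩
    · let D : Set (List Bool) := {t | (M t).Dom}
      have hD : ∀ s ∈ D, ∀ t ∈ D, s <+: t → s = t := fun s hs t ht h => hM.2 s t hs ht h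
      -- The union is indexed by programs rather than outputs, so that Kraft's inequality applies to
      -- the prefix-free domain.
      have hsub : V c ⊆ ⋃ t : D, {q | t.1.length + c < ((M t).get t.2).length ∧
          q ∈ cylinder ((M t).get t.2)} := by
        rintro q ⟨t, w, ⟨ht, rfl⟩, hl, hq⟩
        exact Set.mem_iUnion.2 ⟨⟨t, ht⟩, hl, hq⟩
      calc cantorMeasure (V c)
          ≤ ∑' t : D, cantorMeasure {q | t.1.length + c < ((M t).get t.2).length ∧
              q ∈ cylinder ((M t).get t.2)} :=
            (MeasureTheory.measure_mono hsub).trans (MeasureTheory.measure_iUnion_le _)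
        _ ≤ ∑' t : D, (2 ^ c : ℝ≥0∞)⁻¹ * (2 ^ t.1.length : ℝ≥0∞)⁻¹ := by
            refine ENNReal.tsum_le_tsum fun t => ?_
            by_cases hl : t.1.length + c < ((M t).get t.2).length
            · refine (MeasureTheory.measure_mono (t := cylinder ((M t).get t.2))
                fun q hq => hq.2).trans ?_
              rw [cantorMeasure_cylinder, ← ENNReal.mul_inv (by simp) (by simp), ← pow_add,
                ENNReal.inv_le_inv]
              exact pow_le_pow_right₀ one_le_two (by omega)
            · simp [hl]
        _ ≤ (2 ^ c : ℝ≥0∞)⁻¹ * 1 := by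
            rw [ENNReal.tsum_mul_left]
            gcongr
            exact tsum_prefixFree_le_one hD
        _ = _ := mul_one _
  have h := hp V hV
  rw [Set.mem_iInter, not_forall] at h
  obtain ⟨c, hc⟩ := h
  refine ⟨c, mem_deficiencyBounds_iff.2 fun t w hw hpw => ?_⟩
  by_contra hlt
  exact hc ⟨t, w, hw, not_le.1 hlt, hpw⟩

theorem Kol_nonempty {M : List Bool →. List Bool} (hM : IsPrefixFreeMachine M) (p : MLR) :
    (Kol M p).Nonempty := by
  classical
  have h := exists_mem_deficiencyBounds hM p.2
  exact ⟨Nat.find h, Nat.find_spec h, fun _ => Nat.find_min' h⟩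

/-! ### Computable functions from finite lookups -/

theorem mem_rfindOpt_of_forall_eq {f : ℕ → Option ℕ} {v : ℕ} (h₁ : ∃ k, f k = some v)
    (h₂ : ∀ k u, f k = some u → u = v) (u : ℕ) : u ∈ Nat.rfindOpt f ↔ u = v := by
  constructor
  · intro h
    obtain ⟨k, hk⟩ := Nat.rfindOpt_spec h
    exact h₂ k u hk
  · rintro rfl
    obtain ⟨k, hk⟩ := h₁
    have hd : (Nat.rfindOpt f).Dom := Nat.rfindOpt_dom.2 ⟨k, u, hk⟩
    obtain ⟨k', hk'⟩ := Nat.rfindOpt_spec (Part.get_mem hd)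
    exact h₂ _ _ hk' ▸ Part.get_mem hd

/-- A total function on Baire space is computable if a primitive recursive `f` finds its `n`-th
value from every prefix `w` of the input whose length is at least `b n w`, where `b` is primitive
recursive. -/
theorem computableFun_of_prefix {Φ : (ℕ → ℕ) → ℕ → ℕ} {f : ℕ → List ℕ → ℕ}
    {b : ℕ → List ℕ → ℕ} (hf : Primrec₂ f) (hb : Primrec₂ b)
    (hlong : ∀ n x, ∃ k, b n (prefixOf x k) ≤ k)
    (hΦ : ∀ n x k, b n (prefixOf x k) ≤ k → f n (prefixOf x k) = Φ x n) :
    ComputableFun fun x => Part.some (Φ x) := by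
  refine ⟨fun y => if b y.1 y.2 ≤ y.2.length then some (f y.1 y.2) else none, ?_, ?_⟩
  · exact (Primrec.ite (Primrec.nat_le.comp hb (Primrec.list_length.comp Primrec.snd))
      (Primrec.option_some.comp hf) (Primrec.const none)).to_comp
  · intro x q
    rw [Part.mem_some_iff, funext_iff]
    refine forall_congr' fun n => (mem_rfindOpt_of_forall_eq ?_ ?_ _).symm
    · obtain ⟨k, hk⟩ := hlong n x
      exact ⟨k, by simp only [length_prefixOf, if_pos hk, hΦ n x k hk]⟩
    · intro k u hu
      simp only [length_prefixOf] at hu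
      split_ifs at hu with hk
      cases hu
      exact hΦ n x k hk

theorem exists_eq_toBaire {p : ℕ → ℕ} (h : ∀ n, p n ≤ 1) :
    p = toBaire fun n => decide (p n = 1) := by
  funext n
  have := h n
  simp only [toBaire]
  interval_cases p n <;> rfl

/-! ### The deficiency as the maximum of a computable sequence -/

/-- The deficiency that the `e`-th pair of the graph exhibits for the sequences with prefix `l`. -/
def defect (E : ℕ → Option (List Bool × List Bool)) (l : List ℕ) (e : ℕ) : ℕ :=
  (E e).elim 0 fun x =>
    if l.take x.2.length = x.2.map Bool.toNat then x.2.length - x.1.length else 0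

theorem primrec_defect {E : ℕ → Option (List Bool × List Bool)} (hE : Primrec E) :
    Primrec₂ (defect E) := by
  have h : Primrec fun y : List ℕ × ℕ => (Option.casesOn (E y.2) 0 fun x : List Bool × List Bool =>
      if y.1.take x.2.length = x.2.map Bool.toNat then x.2.length - x.1.length else 0 : ℕ) := by
    refine Primrec.option_casesOn (hE.comp Primrec.snd) (Primrec.const 0) ?_
    refine Primrec.ite ?_ ?_ ?_
    · refine Primrec.eq.comp (Primrec.list_take.comp ?_ (Primrec.fst.comp Primrec.fst)) ?_
      · exact Primrec.list_length.comp (Primrec.snd.comp Primrec.snd)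
      · exact Primrec.list_map (Primrec.snd.comp Primrec.snd)
          ((Primrec.dom_finite Bool.toNat).comp Primrec.snd).to₂
    · exact Primrec.nat_sub.comp (Primrec.list_length.comp (Primrec.snd.comp Primrec.snd))
        (Primrec.list_length.comp (Primrec.fst.comp Primrec.snd))
    · exact Primrec.const 0
  exact h.of_eq fun y => by cases h : E y.2 <;> simp [defect, h]

/-- A pair listed at stage `e` has `|w| ≤ e`, so its defect depends on `e` entries of the input
only. -/
theorem defect_prefixOf {E : ℕ → Option (List Bool × List Bool)} {M : List Bool →. List Bool}
    (hE : EnumeratesGraph E M) (x : ℕ → ℕ) {e k : ℕ} (h : e ≤ k) :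
    defect E (prefixOf x k) e = defect E (prefixOf x e) e := by
  rcases hEe : E e with - | ⟨t, w⟩
  · simp [defect, hEe]
  · have := hE.length_le hEe
    simp [defect, hEe, take_prefixOf _ this, take_prefixOf _ (this.trans h)]

/-- The default `0` and the truncated subtraction are harmless, since `c` is a natural number. -/
theorem mem_deficiencyBounds_iff_defect {E : ℕ → Option (List Bool × List Bool)}
    {M : List Bool →. List Bool} (hE : EnumeratesGraph E M) {p : ℕ → Bool} {c : ℕ} :
    c ∈ deficiencyBounds M p ↔ ∀ e, defect E (prefixOf (toBaire p) e) e ≤ c := by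
  have hmap : ∀ w : List Bool, prefixOf (toBaire p) w.length = w.map Bool.toNat ↔
      prefixOf p w.length = w := by
    intro w
    have hinj : Function.Injective Bool.toNat := by decide
    rw [← hinj.list_map.eq_iff, map_prefixOf]
    rfl
  rw [mem_deficiencyBounds_iff]
  constructor
  · intro h e
    rcases hEe : E e with - | ⟨t, w⟩
    · simp [defect, hEe]
    · simp only [defect, hEe, Option.elim_some, take_prefixOf _ (hE.length_le hEe), hmap]
      split_ifs with hp
      · have := h t w (hE.mem_iff.2 ⟨e, hEe⟩) hp
        omega
      · exact Nat.zero_le _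
  · intro h t w hw hp
    obtain ⟨e, he⟩ := hE.mem_iff.1 hw
    have := h e
    simp only [defect, he, Option.elim_some, take_prefixOf _ (hE.length_le he), hmap, if_pos hp]
      at this
    omega

/-- A name for the set of all `⟨c, e⟩` such that `c` is the value at `e`, and the maximum, of the
sequence of defects. -/
def argmaxName (E : ℕ → Option (List Bool × List Bool)) (l : List ℕ) (n : ℕ) : ℕ :=
  if defect E l n.unpair.1.unpair.2 = n.unpair.1.unpair.1 ∧
    defect E l n.unpair.2 ≤ n.unpair.1.unpair.1 then 0 else n.unpair.1 + 1

theorem primrec_argmaxName {E : ℕ → Option (List Bool × List Bool)} (hE : Primrec E) :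
    Primrec₂ (argmaxName E) := by
  have h₁ : Primrec fun y : List ℕ × ℕ => y.2.unpair.1 :=
    Primrec.fst.comp (Primrec.unpair.comp Primrec.snd)
  have h₂ : Primrec fun y : List ℕ × ℕ => y.2.unpair.2 :=
    Primrec.snd.comp (Primrec.unpair.comp Primrec.snd)
  have h₃ : Primrec fun y : List ℕ × ℕ => y.2.unpair.1.unpair.1 :=
    Primrec.fst.comp (Primrec.unpair.comp h₁)
  refine Primrec.ite (PrimrecPred.and (Primrec.eq.comp ((primrec_defect hE).comp Primrec.fst
    (Primrec.snd.comp (Primrec.unpair.comp h₁))) h₃)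
    (Primrec.nat_le.comp ((primrec_defect hE).comp Primrec.fst h₂) h₃)) (Primrec.const 0)
    (Primrec.succ.comp h₁)

theorem reducible_Kol {M : List Bool →. List Bool} (hM : IsPrefixFreeMachine M) :
    Reducible (Kol M) (multiProd closedChoiceNat (constOn (toBaire '' MLR))) := by
  obtain ⟨E, hE⟩ := exists_enumeratesGraph hM.1
  let Φ : (ℕ → ℕ) → ℕ → ℕ := fun x => pair (fun m => argmaxName E (prefixOf x m) m) x
  refine ⟨fun x => Part.some fun _ => (x 1).unpair.1, fun x => Part.some (Φ x), ?_, ?_, ?_⟩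
  · refine computableFun_of_prefix (f := fun _ l => (l.getD 1 0).unpair.1) (b := fun _ _ => 2)
      ?_ (Primrec.const 2) (fun _ _ => ⟨2, le_rfl⟩) fun n x k hk => ?_
    · exact Primrec.fst.comp (Primrec.unpair.comp
        ((Primrec.list_getD 0).comp Primrec.snd (Primrec.const 1)))
    · rw [getD_prefixOf _ hk]
  · refine computableFun_of_prefix
      (f := fun n l => if n % 2 = 0 then argmaxName E l (n / 2) else l.getD (n / 2) 0)
      (b := fun n _ => n + 1) ?_ (Primrec.succ.comp Primrec.fst) (fun n _ => ⟨n + 1, le_rfl⟩)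
      fun n x k hk => ?_
    · have h : Primrec fun y : ℕ × List ℕ => y.1 / 2 :=
        Primrec.nat_div.comp Primrec.fst (Primrec.const 2)
      exact Primrec.ite (Primrec.eq.comp (Primrec.nat_mod.comp Primrec.fst (Primrec.const 2))
        (Primrec.const 0)) ((primrec_argmaxName hE.primrec).comp Primrec.snd h)
        ((Primrec.list_getD 0).comp Primrec.snd h)
    · simp only [Φ, pair]
      split_ifs with h
      -- Unpairing does not increase numbers, so the entry `m = n / 2` of the name only asks for
      -- defects at positions up to `m`.
      · have h₁ : (n / 2).unpair.1.unpair.2 ≤ n / 2 :=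
          (Nat.unpair_right_le _).trans (Nat.unpair_left_le _)
        have h₂ : (n / 2).unpair.2 ≤ n / 2 := Nat.unpair_right_le _
        have h₃ : n / 2 ≤ k := by omega
        simp only [argmaxName]
        rw [defect_prefixOf hE x h₁, defect_prefixOf hE x h₂,
          defect_prefixOf hE x (h₁.trans h₃), defect_prefixOf hE x (h₂.trans h₃)]
      · exact getD_prefixOf _ (by omega) 0
  · intro G hG x p hp hne
    obtain ⟨⟨hx01, hxM⟩, rfl⟩ := hp
    set q : ℕ → Bool := fun n => decide (x n = 1) with hq
    have hxq : x = toBaire q := exists_eq_toBaire hx01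
    obtain ⟨c, hc, hcmin⟩ := hne
    set d : ℕ → ℕ := fun e => defect E (prefixOf x e) e with hd
    have hbd : ∀ c', c' ∈ deficiencyBounds M q ↔ ∀ e, d e ≤ c' := fun c' => by
      rw [mem_deficiencyBounds_iff_defect hE, ← hxq]
    let A : ClosedSubsets :=
      ⟨{n | ¬ ∃ i, (fun m => argmaxName E (prefixOf x m) m) i = n + 1}⟩
    have hA : ∀ n, n ∈ A.carrier ↔ d n.unpair.2 = n.unpair.1 ∧ ∀ e, d e ≤ n.unpair.1 := by
      intro n
      have key : ∀ i, argmaxName E (prefixOf x i) i =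
          if d i.unpair.1.unpair.2 = i.unpair.1.unpair.1 ∧ d i.unpair.2 ≤ i.unpair.1.unpair.1
          then 0 else i.unpair.1 + 1 := by
        intro i
        rw [argmaxName, defect_prefixOf hE x
          ((Nat.unpair_right_le _).trans (Nat.unpair_left_le _)),
          defect_prefixOf hE x (Nat.unpair_right_le _)]
      simp only [A, Set.mem_ofPred_eq, key]
      constructor
      · intro h
        have h' : ∀ e, d n.unpair.2 = n.unpair.1 ∧ d e ≤ n.unpair.1 := fun e => by
          by_contra hcon
          exact h ⟨Nat.pair n e, by simp only [Nat.unpair_pair, if_neg hcon]⟩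
        exact ⟨(h' 0).1, fun e => (h' e).2⟩
      · rintro ⟨h₁, h₂⟩ ⟨i, hi⟩
        split_ifs at hi with hcon
        have : i.unpair.1 = n := Nat.succ_injective hi
        rw [this] at hcon
        exact hcon ⟨h₁, h₂ _⟩
    -- The least bound is attained: if it is `0`, all defects vanish and position `0` serves;
    -- otherwise `c - 1` fails at some `e`, where the defect must be `c`.
    have hAne : A.carrier.Nonempty := by
      rcases Nat.eq_zero_or_pos c with hc0 | hc0
      · refine ⟨Nat.pair 0 0, (hA _).2 ?_⟩
        have := (hbd c).1 hc
        simp only [Nat.unpair_pair]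
        exact ⟨Nat.le_zero.1 (hc0 ▸ this 0), fun e => hc0 ▸ this e⟩
      · have hnot : c - 1 ∉ deficiencyBounds M q := fun h => by
          have := hcmin h
          omega
        rw [hbd, not_forall] at hnot
        obtain ⟨e, he⟩ := hnot
        have hmax := (hbd c).1 hc
        refine ⟨Nat.pair c e, (hA _).2 ?_⟩
        simp only [Nat.unpair_pair]
        have := hmax e
        exact ⟨by omega, hmax⟩
    have hxim : x ∈ toBaire '' MLR := ⟨q, hxM, hxq.symm⟩
    have hname : ((A, ⟨x, hxim⟩) : ClosedSubsets × (toBaire '' MLR : Set (ℕ → ℕ))) ∈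
        RepresentedSpace.rep (Φ x) := by
      have h₁ : (fun n => Φ x (2 * n + 1)) = x := pair_odd _ _
      have h₂ : (fun n => Φ x (2 * n)) = fun m => argmaxName E (prefixOf x m) m := pair_even _ _
      refine ⟨⟨trivial, trivial, ?_⟩, ?_⟩
      · change (fun n => Φ x (2 * n + 1)) ∈ toBaire '' MLR
        rw [h₁]; exact hxim
      · refine Prod.ext ?_ (Subtype.ext h₁)
        change ClosedSubsets.mk {n | ¬ ∃ i, (fun n => Φ x (2 * n)) i = n + 1} = A
        rw [h₂]
    obtain ⟨s, hs, y, hy, hyA, -⟩ := hG (Φ x) _ hname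
      (Set.Nonempty.prod hAne (Set.singleton_nonempty _))
    obtain ⟨hdom, rfl⟩ := hy
    have hs0 : s 0 ∈ A.carrier := hyA
    refine ⟨fun _ => (s 0).unpair.1, ?_, (s 0).unpair.1, Part.mem_some _, ?_⟩
    · exact Part.mem_bind (Part.mem_some _) (Part.mem_bind hs (Part.mem_some _))
    · obtain ⟨h₁, h₂⟩ := (hA _).1 hs0
      exact ⟨(hbd _).2 h₂, fun c' hc' => h₁ ▸ (hbd c').1 hc' _⟩

/-! ### Guessing an element of a set from an enumeration of its complement -/

/-- The guess at stage `s` for an element of the set named by `r`: it is increased whenever it has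
been enumerated into the complement. -/
def guess (r : ℕ → ℕ) : ℕ → ℕ
  | 0 => 0
  | s + 1 => if guess r s + 1 ∈ prefixOf r (s + 1) then guess r s + 1 else guess r s

/-- The guess at stage `s` is refuted by the first `s + 1` entries of `r`. -/
def Refuted (r : ℕ → ℕ) (s : ℕ) : Prop := guess r s + 1 ∈ prefixOf r (s + 1)

theorem refuted_iff {r : ℕ → ℕ} {s : ℕ} : Refuted r s ↔ ∃ i ≤ s, r i = guess r s + 1 := by
  simp [Refuted, prefixOf]

theorem guess_succ_of_refuted {r : ℕ → ℕ} {s : ℕ} (h : Refuted r s) :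
    guess r (s + 1) = guess r s + 1 := if_pos h

theorem guess_succ_of_not_refuted {r : ℕ → ℕ} {s : ℕ} (h : ¬ Refuted r s) :
    guess r (s + 1) = guess r s := if_neg h

/-- The guess climbs in steps of one, and it could leave an element `a` of the set only by a
refutation of `a`. -/
theorem guess_le {r : ℕ → ℕ} {a : ℕ} (ha : ¬ ∃ i, r i = a + 1) (s : ℕ) : guess r s ≤ a := by
  induction s with
  | zero => exact Nat.zero_le _
  | succ s ih =>
    by_cases h : Refuted r s
    · rw [guess_succ_of_refuted h]
      refine lt_of_le_of_ne ih fun heq => ?_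
      obtain ⟨i, -, hi⟩ := refuted_iff.1 h
      exact ha ⟨i, heq ▸ hi⟩
    · rwa [guess_succ_of_not_refuted h]

theorem guess_mono (r : ℕ → ℕ) : Monotone (guess r) := by
  refine monotone_nat_of_le_succ fun s => ?_
  by_cases h : Refuted r s
  · rw [guess_succ_of_refuted h]; exact Nat.le_succ _
  · rw [guess_succ_of_not_refuted h]

theorem exists_forall_not_refuted {r : ℕ → ℕ} {a : ℕ} (ha : ¬ ∃ i, r i = a + 1) :
    ∃ s₀, ∀ s ≥ s₀, ¬ Refuted r s := by
  by_contra! hcon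
  have : ∀ n, ∃ s, n ≤ guess r s := by
    intro n
    induction n with
    | zero => exact ⟨0, Nat.zero_le _⟩
    | succ n ih =>
      obtain ⟨s, hs⟩ := ih
      obtain ⟨s', hs', hr⟩ := hcon s
      exact ⟨s' + 1, by
        rw [guess_succ_of_refuted hr]
        exact Nat.succ_le_succ (hs.trans (guess_mono r hs'))⟩
  obtain ⟨s, hs⟩ := this (a + 1)
  exact absurd (guess_le ha s) (by omega)

/-- A stable guess that `r` lists at position `i` would be refuted at every stage from `max s₀ i`
on. -/
theorem guess_mem_of_forall_not_refuted {r : ℕ → ℕ} {s₀ : ℕ} (h : ∀ s ≥ s₀, ¬ Refuted r s) :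
    ¬ ∃ i, r i = guess r s₀ + 1 := by
  rintro ⟨i, hi⟩
  have hconst : ∀ s ≥ s₀, guess r s = guess r s₀ := by
    intro s hs
    induction s, hs using Nat.le_induction with
    | base => rfl
    | succ s hs ih => rw [guess_succ_of_not_refuted (h s hs), ih]
  refine h (max s₀ i) (le_max_left _ _) (refuted_iff.2 ⟨i, le_max_right _ _, ?_⟩)
  rw [hconst _ (le_max_left _ _), hi]

theorem guess_congr {r r' : ℕ → ℕ} {s : ℕ} (h : ∀ i < s, r i = r' i) :
    guess r s = guess r' s := by
  induction s with
  | zero => rfl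
  | succ s ih =>
    have : prefixOf r (s + 1) = prefixOf r' (s + 1) :=
      List.map_congr_left fun i hi => h i (List.mem_range.1 hi)
    simp only [guess, this, ih fun i hi => h i (hi.trans (Nat.lt_succ_self s))]

/-! ### Lowering the complexity of finitely many prefixes -/

/-- The number that codes the word `w` and the bound `m`. -/
def padCode (w : List ℕ) (m : ℕ) : ℕ := Nat.pair (Encodable.encode w) m

/-- Words built from `p`: each time the guess for `r` is refuted, a long block of zeros is inserted
and `p` is started anew. -/
def padWord (c : ℕ) (r p : ℕ → ℕ) : ℕ → List ℕ
  | 0 => []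
  | s + 1 =>
    if guess r s + 1 ∈ prefixOf r (s + 1) then
      padWord c r p s ++ List.replicate (2 * padCode (padWord c r p s) (s + c + 1)) 0 ++
        prefixOf p (s + 1)
    else padWord c r p s ++ [p s]

/-- The limit of the words `padWord c r p s`. -/
def padSeq (c : ℕ) (r p : ℕ → ℕ) (n : ℕ) : ℕ := (padWord c r p (n + 1)).getD n 0

section

variable {c : ℕ} {r p : ℕ → ℕ} {s : ℕ}

theorem padWord_succ_of_refuted (h : Refuted r s) :
    padWord c r p (s + 1) =
      padWord c r p s ++ List.replicate (2 * padCode (padWord c r p s) (s + c + 1)) 0 ++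
        prefixOf p (s + 1) := if_pos h

theorem padWord_succ_of_not_refuted (h : ¬ Refuted r s) :
    padWord c r p (s + 1) = padWord c r p s ++ [p s] := if_neg h

theorem padWord_prefix_succ : padWord c r p s <+: padWord c r p (s + 1) := by
  by_cases h : Refuted r s
  · rw [padWord_succ_of_refuted h, List.append_assoc]; exact List.prefix_append _ _
  · rw [padWord_succ_of_not_refuted h]; exact List.prefix_append _ _

theorem padWord_prefix {s' : ℕ} (h : s ≤ s') : padWord c r p s <+: padWord c r p s' := by
  induction s', h using Nat.le_induction with
  | base => exact List.prefix_rfl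
  | succ s' _ ih => exact ih.trans padWord_prefix_succ

/-- A restart copies `s + 1` entries of `p` at once, so the copy of `p` never lags behind the stage.
-/
theorem exists_padWord_eq_append (s : ℕ) : ∃ u, padWord c r p s = u ++ prefixOf p s := by
  induction s with
  | zero => exact ⟨[], rfl⟩
  | succ s ih =>
    by_cases h : Refuted r s
    · exact ⟨_, padWord_succ_of_refuted h⟩
    · obtain ⟨u, hu⟩ := ih
      exact ⟨u, by rw [padWord_succ_of_not_refuted h, hu, prefixOf_succ, List.append_assoc]⟩

/-- This ensures that the default value in `padSeq` is never used. -/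
theorem le_length_padWord (s : ℕ) : s ≤ (padWord c r p s).length := by
  obtain ⟨u, hu⟩ := exists_padWord_eq_append (c := c) (r := r) (p := p) s
  simp [hu]

theorem padWord_le_one (hp : ∀ n, p n ≤ 1) : ∀ s, ∀ v ∈ padWord c r p s, v ≤ 1 := by
  intro s
  induction s with
  | zero => simp [padWord]
  | succ s ih =>
    by_cases h : Refuted r s
    · rw [padWord_succ_of_refuted h]
      intro v hv
      simp only [List.mem_append, List.mem_replicate, prefixOf, List.mem_map] at hv
      rcases hv with (hv | ⟨-, rfl⟩) | ⟨i, -, rfl⟩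
      · exact ih v hv
      · exact Nat.zero_le _
      · exact hp i
    · rw [padWord_succ_of_not_refuted h]
      intro v hv
      simp only [List.mem_append, List.mem_singleton] at hv
      rcases hv with hv | rfl
      · exact ih v hv
      · exact hp s

theorem prefixOf_padSeq {v : List ℕ} (hv : v <+: padWord c r p s) :
    prefixOf (padSeq c r p) v.length = v := by
  refine (prefixOf_eq_iff _ _).2 fun i hi => ?_
  have h₁ : i < (padWord c r p (i + 1)).length := le_length_padWord (i + 1)
  rw [padSeq, List.getD_eq_getElem _ _ h₁]
  have h₂ := hv.trans (padWord_prefix (c := c) (r := r) (p := p) (le_max_left s (i + 1)))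
  have h₃ := padWord_prefix (c := c) (r := r) (p := p) (le_max_right s (i + 1))
  rw [h₂.getElem hi, h₃.getElem h₁]

theorem padSeq_le_one (hp : ∀ n, p n ≤ 1) (n : ℕ) : padSeq c r p n ≤ 1 := by
  have h : n < (padWord c r p (n + 1)).length := le_length_padWord (n + 1)
  rw [padSeq, List.getD_eq_getElem _ _ h]
  exact padWord_le_one hp _ _ (List.getElem_mem h)

/-- After the last refutation the part `u` in front of the copy of `p` no longer changes. -/
theorem exists_padSeq_shift {s₀ : ℕ} (h : ∀ s ≥ s₀, ¬ Refuted r s) :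
    ∃ m, ∀ n, padSeq c r p (n + m) = p n := by
  obtain ⟨u, hu⟩ := exists_padWord_eq_append (c := c) (r := r) (p := p) s₀
  have hu' : ∀ s ≥ s₀, padWord c r p s = u ++ prefixOf p s := by
    intro s hs
    induction s, hs using Nat.le_induction with
    | base => exact hu
    | succ s hs ih =>
      rw [padWord_succ_of_not_refuted (h s hs), ih, prefixOf_succ, List.append_assoc]
  refine ⟨u.length, fun n => ?_⟩
  have h₁ := hu' (max s₀ (n + 1)) (le_max_left _ _)
  have h₂ := prefixOf_padSeq (c := c) (r := r) (p := p) (s := max s₀ (n + 1)) List.prefix_rfl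
  have hn : n < max s₀ (n + 1) := lt_of_lt_of_le (Nat.lt_succ_self n) (le_max_right _ _)
  have h₃ : n + u.length < (padWord c r p (max s₀ (n + 1))).length := by
    rw [h₁, List.length_append, length_prefixOf]
    omega
  rw [(prefixOf_eq_iff _ _).1 h₂ _ h₃]
  simp only [h₁]
  rw [List.getElem_append_right (Nat.le_add_left _ _)]
  simp [prefixOf]

theorem padWord_congr {r' p' : ℕ → ℕ} (hr : ∀ i < s, r i = r' i) (hp : ∀ i < s, p i = p' i) :
    padWord c r p s = padWord c r' p' s := by
  induction s with
  | zero => rfl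
  | succ s ih =>
    have h₁ : prefixOf r (s + 1) = prefixOf r' (s + 1) :=
      List.map_congr_left fun i hi => hr i (List.mem_range.1 hi)
    have h₂ : prefixOf p (s + 1) = prefixOf p' (s + 1) :=
      List.map_congr_left fun i hi => hp i (List.mem_range.1 hi)
    have h₃ : ∀ i < s, r i = r' i := fun i hi => hr i (hi.trans (Nat.lt_succ_self s))
    simp only [padWord, h₁, h₂, guess_congr h₃, hp s (Nat.lt_succ_self s),
      ih h₃ fun i hi => hp i (hi.trans (Nat.lt_succ_self s))]

end

/-! ### Primitive recursiveness of the construction -/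

section

variable {α : Type*} [Primcodable α] {ρ π : α → ℕ → ℕ}

theorem primrec_prefixOf (hρ : Primrec₂ ρ) : Primrec₂ fun a n => prefixOf (ρ a) n :=
  Primrec.list_map (Primrec.list_range.comp Primrec.snd)
    (hρ.comp (Primrec.fst.comp Primrec.fst) Primrec.snd)

theorem primrecRel_mem : PrimrecRel fun (n : ℕ) (l : List ℕ) => n ∈ l :=
  (PrimrecRel.swap (PrimrecRel.exists_mem_list (R := Eq) (Primrec.eq (α := ℕ)))).of_eq
    fun n l => by simp

/-- The sequences form a family with a parameter `a`, because in the reduction they are read off a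
finite list by `List.getD`. -/
theorem primrec_guess (hρ : Primrec₂ ρ) : Primrec₂ fun a s => guess (ρ a) s := by
  have h : Primrec₂ fun (a : α) (s : ℕ) => (Nat.rec 0 (fun s g =>
      if g + 1 ∈ prefixOf (ρ a) (s + 1) then g + 1 else g) s : ℕ) := by
    refine Primrec.nat_rec (g := fun a (x : ℕ × ℕ) =>
      if x.2 + 1 ∈ prefixOf (ρ a) (x.1 + 1) then x.2 + 1 else x.2) (Primrec.const 0) ?_
    have h₁ : Primrec fun y : α × ℕ × ℕ => y.2.2 + 1 :=
      Primrec.succ.comp (Primrec.snd.comp Primrec.snd)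
    exact Primrec.ite (primrecRel_mem.comp h₁ ((primrec_prefixOf hρ).comp Primrec.fst
      (Primrec.succ.comp (Primrec.fst.comp Primrec.snd)))) h₁ (Primrec.snd.comp Primrec.snd)
  refine h.of_eq fun a s => ?_
  induction s with
  | zero => rfl
  | succ s ih => simp only [guess, ← ih]

theorem primrec_replicate {β : Type*} [Primcodable β] (b : β) :
    Primrec fun n => List.replicate n b :=
  (Primrec.list_map Primrec.list_range (Primrec.const b).to₂).of_eq fun n => by simp

theorem primrec_padWord (c : ℕ) (hρ : Primrec₂ ρ) (hπ : Primrec₂ π) :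
    Primrec₂ fun a s => padWord c (ρ a) (π a) s := by
  have h : Primrec₂ fun (a : α) (s : ℕ) => (Nat.rec [] (fun s w =>
      if guess (ρ a) s + 1 ∈ prefixOf (ρ a) (s + 1) then
        w ++ List.replicate (2 * padCode w (s + c + 1)) 0 ++ prefixOf (π a) (s + 1)
      else w ++ [π a s]) s : List ℕ) := by
    refine Primrec.nat_rec (g := fun a (x : ℕ × List ℕ) =>
      if guess (ρ a) x.1 + 1 ∈ prefixOf (ρ a) (x.1 + 1) then
        x.2 ++ List.replicate (2 * padCode x.2 (x.1 + c + 1)) 0 ++ prefixOf (π a) (x.1 + 1)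
      else x.2 ++ [π a x.1]) (Primrec.const []) ?_
    have h₁ : Primrec fun y : α × ℕ × List ℕ => y.2.1 := Primrec.fst.comp Primrec.snd
    have h₂ : Primrec fun y : α × ℕ × List ℕ => y.2.2 := Primrec.snd.comp Primrec.snd
    have h₃ := Primrec.succ.comp h₁
    refine Primrec.ite (primrecRel_mem.comp (Primrec.succ.comp ((primrec_guess hρ).comp
      Primrec.fst h₁)) ((primrec_prefixOf hρ).comp Primrec.fst h₃)) ?_ ?_
    · refine Primrec.list_append.comp (Primrec.list_append.comp h₂
        ((primrec_replicate 0).comp (Primrec.nat_mul.comp (Primrec.const 2) ?_)))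
        ((primrec_prefixOf hπ).comp Primrec.fst h₃)
      exact Primrec₂.natPair.comp (Primrec.encode.comp h₂)
        (Primrec.succ.comp (Primrec.nat_add.comp h₁ (Primrec.const c)))
    · exact Primrec.list_concat.comp h₂ (hπ.comp Primrec.fst h₁)
  refine h.of_eq fun a s => ?_
  induction s with
  | zero => rfl
  | succ s ih => simp only [padWord, ← ih]

end

/-! ### A machine with short programs for padded words -/

/-- The word coded by `k`, followed by a block of `2 * k` zeros. -/
def padded (k : ℕ) : List Bool :=
  ((Encodable.decode k.unpair.1 : Option (List ℕ)).getD []).map (fun n => decide (n = 1)) ++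
    List.replicate (2 * k) false

/-- The unary program for `k`. -/
def unary (k : ℕ) : List Bool := List.replicate k true ++ [false]

theorem unary_prefix {k m : ℕ} (h : unary k <+: unary m) : unary k = unary m := by
  have hl : k ≤ m := by simpa [unary] using h.length_le
  rcases hl.eq_or_lt with rfl | hlt
  · rfl
  · have hk : k < (unary k).length := by simp [unary]
    have := h.getElem hk
    simp [unary, List.getElem_append_left, hlt] at this

theorem primrec_padded : Primrec padded := by
  refine Primrec.list_append.comp (Primrec.list_map
    (Primrec.option_getD.comp (Primrec.decode.comp (Primrec.fst.comp Primrec.unpair))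
      (Primrec.const [])) ?_)
    ((primrec_replicate false).comp (Primrec.nat_mul.comp (Primrec.const 2) Primrec.id))
  exact (Primrec.eq.comp Primrec.snd (Primrec.const 1)).decide

/-- The machine which maps the unary program for `k` to the padded word coded by `k`. -/
def padMachine (t : List Bool) : Part (List Bool) :=
  (if t = unary (t.length - 1) then some (padded (t.length - 1)) else none : Option (List Bool))

theorem isPrefixFreeMachine_padMachine : IsPrefixFreeMachine padMachine := by
  have hlen : Primrec fun t : List Bool => t.length - 1 :=
    Primrec.pred.comp Primrec.list_length
  refine ⟨Computable.ofOption (Primrec.to_comp ?_), fun s t hs ht h => ?_⟩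
  · exact Primrec.ite (Primrec.eq.comp Primrec.id (Primrec.list_concat.comp
      ((primrec_replicate true).comp hlen) (Primrec.const false)))
      (Primrec.option_some.comp (primrec_padded.comp hlen)) (Primrec.const none)
  · have key : ∀ t, (padMachine t).Dom → t = unary (t.length - 1) := by
      intro t ht
      by_contra hne
      simp [padMachine, hne] at ht
    rw [key s hs, key t ht] at h ⊢
    exact unary_prefix h

theorem padded_mem_padMachine (k : ℕ) : padded k ∈ padMachine (unary k) := by
  have : (unary k).length - 1 = k := by simp [unary]
  simp [padMachine, this]

theorem exists_padded_bound {M : List Bool →. List Bool} (hM : IsUniversalPrefixFreeMachine M) :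
    ∃ c, ∀ k q d, d ∈ deficiencyBounds M q → prefixOf q (padded k).length = padded k →
      (padded k).length ≤ k + 1 + c + d := by
  obtain ⟨c, hc⟩ := hM.2 _ isPrefixFreeMachine_padMachine
  refine ⟨c, fun k q d hd hq => ?_⟩
  obtain ⟨t, ht, hl⟩ := hc _ _ (padded_mem_padMachine k)
  have h₁ := mem_deficiencyBounds_iff.1 hd t _ ht hq
  have h₂ : (unary k).length = k + 1 := by simp [unary]
  omega

/-- From `2 * k ≤ k + 1 + c + d` and `s + c + 1 ≤ k` it follows that `s ≤ d`; the summand `c + 1` in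
the code absorbs the overhead of the programs. -/
theorem le_of_refuted {M : List Bool →. List Bool} {c : ℕ}
    (hc : ∀ k q d, d ∈ deficiencyBounds M q → prefixOf q (padded k).length = padded k →
      (padded k).length ≤ k + 1 + c + d)
    {r p : ℕ → ℕ} {s d : ℕ} (hs : Refuted r s)
    (hd : d ∈ deficiencyBounds M fun n => decide (padSeq c r p n = 1)) : s ≤ d := by
  set k := padCode (padWord c r p s) (s + c + 1) with hk
  set v := padWord c r p s ++ List.replicate (2 * k) 0 with hv
  have hpre : v <+: padWord c r p (s + 1) := by
    rw [padWord_succ_of_refuted hs]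
    exact List.prefix_append _ _
  have hpad : padded k = v.map fun n => decide (n = 1) := by
    simp [padded, hv, hk, padCode]
  have hlen : (padded k).length = v.length := by rw [hpad, List.length_map]
  have h := hc k _ d hd (by
    rw [hlen, ← map_prefixOf (fun n : ℕ => decide (n = 1)), prefixOf_padSeq hpre, hpad])
  have h₁ : s + c + 1 ≤ k := Nat.right_le_pair _ _
  have h₂ : 2 * k ≤ v.length := by simp [hv]
  omega

theorem Kol_reducible {M : List Bool →. List Bool} (hM : IsUniversalPrefixFreeMachine M) :
    Reducible (multiProd closedChoiceNat (constOn (toBaire '' MLR))) (Kol M) := by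
  obtain ⟨c, hc⟩ := exists_padded_bound hM
  let Φ : (ℕ → ℕ) → ℕ → ℕ := fun x =>
    padSeq c (fun i => x (2 * i)) fun i => x (2 * i + 1)
  -- For `y = pair x s`, the entry `y 1 = s 0` is the answer of `Kol`, and `y (4 * i) = x (2 * i)`
  -- is the entry `i` of the name of `A`.
  let Ψ : (ℕ → ℕ) → ℕ → ℕ := fun y n =>
    if n % 2 = 0 then guess (fun i => y (4 * i)) (y 1 + 1) else 1
  refine ⟨fun y => Part.some (Ψ y), fun x => Part.some (Φ x), ?_, ?_, ?_⟩
  -- The required length depends on the answer stored at position `1`. On prefixes shorter than `2`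
  -- the default `0` yields the bound `2`, so they are never accepted.
  · refine computableFun_of_prefix
      (f := fun n l => if n % 2 = 0 then guess (fun i => l.getD (4 * i) 0) (l.getD 1 0 + 1) else 1)
      (b := fun _ l => 4 * l.getD 1 0 + 2) ?_ ?_ (fun n x => ⟨4 * x 1 + 2, ?_⟩) fun n x k hk => ?_
    · refine Primrec.ite (Primrec.eq.comp (Primrec.nat_mod.comp Primrec.fst (Primrec.const 2))
        (Primrec.const 0)) ?_ (Primrec.const 1)
      refine (primrec_guess (ρ := fun (l : List ℕ) i => l.getD (4 * i) 0) ?_).comp Primrec.snd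
        (Primrec.succ.comp ((Primrec.list_getD 0).comp Primrec.snd (Primrec.const 1)))
      exact (Primrec.list_getD 0).comp Primrec.fst
        (Primrec.nat_mul.comp (Primrec.const 4) Primrec.snd)
    · exact Primrec.nat_add.comp (Primrec.nat_mul.comp (Primrec.const 4)
        ((Primrec.list_getD 0).comp Primrec.snd (Primrec.const 1))) (Primrec.const 2)
    · rw [getD_prefixOf _ (by omega)]
    · have h1 : (prefixOf x k).getD 1 0 = x 1 := getD_prefixOf _ (by omega) _
      simp only [h1] at hk ⊢
      simp only [Ψ]
      split_ifs
      · exact guess_congr fun i hi => getD_prefixOf _ (by omega) _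
      · rfl
  · refine computableFun_of_prefix
      (f := fun n l => (padWord c (fun i => l.getD (2 * i) 0) (fun i => l.getD (2 * i + 1) 0)
        (n + 1)).getD n 0) (b := fun n _ => 2 * n + 2) ?_ ?_ (fun n _ => ⟨2 * n + 2, le_rfl⟩)
      fun n x k hk => ?_
    · have h₁ : Primrec fun y : List ℕ × ℕ => 2 * y.2 :=
        Primrec.nat_mul.comp (Primrec.const 2) Primrec.snd
      refine (Primrec.list_getD 0).comp ((primrec_padWord
        (ρ := fun (l : List ℕ) i => l.getD (2 * i) 0)
        (π := fun (l : List ℕ) i => l.getD (2 * i + 1) 0) c ?_ ?_).comp Primrec.snd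
        (Primrec.succ.comp Primrec.fst)) Primrec.fst
      · exact (Primrec.list_getD 0).comp Primrec.fst h₁
      · exact (Primrec.list_getD 0).comp Primrec.fst (Primrec.succ.comp h₁)
    · exact Primrec.nat_add.comp (Primrec.nat_mul.comp (Primrec.const 2) Primrec.fst)
        (Primrec.const 2)
    · simp only [Φ, padSeq]
      rw [padWord_congr (fun i hi => getD_prefixOf _ (by omega) _)
        fun i hi => getD_prefixOf _ (by omega) _]
  · intro G hG x a hx hne
    obtain ⟨⟨hxA, hxdom, hxM⟩, rfl⟩ := hx
    set r : ℕ → ℕ := fun i => x (2 * i) with hr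
    set p : ℕ → ℕ := fun i => x (2 * i + 1) with hp
    obtain ⟨⟨n, u⟩, hnu⟩ := hne
    have hn : ¬ ∃ i, r i = n + 1 := hnu.1
    obtain ⟨q, hqM, hqp⟩ : p ∈ toBaire '' MLR := hxM
    have hp1 : ∀ n, p n ≤ 1 := fun n => hqp ▸ Bool.toNat_le (q n)
    obtain ⟨s₀, hs₀⟩ := exists_forall_not_refuted hn
    set z : ℕ → Bool := fun n => decide (padSeq c r p n = 1) with hz
    have hzM : z ∈ MLR := by
      obtain ⟨m, hm⟩ := exists_padSeq_shift (c := c) (p := p) hs₀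
      refine mem_MLR_of_shift hqM m fun n => ?_
      have hn : p n = (q n).toNat := hqp ▸ rfl
      simp only [hz, hm, hn]
      cases q n <;> rfl
    have hname : (⟨z, hzM⟩ : MLR) ∈ RepresentedSpace.rep (Φ x) :=
      ⟨⟨padSeq_le_one hp1, hzM⟩, rfl⟩
    obtain ⟨s, hs, d, hd, hdK⟩ := hG (Φ x) _ hname (Kol_nonempty hM.1 _)
    obtain ⟨hdom, rfl⟩ := hd
    have hd : s 0 ∈ deficiencyBounds M z := hdK.1
    -- A refutation at stage `s 0` itself is still possible, hence the guess is taken at `s 0 + 1`.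
    have hstable : ∀ s' ≥ s 0 + 1, ¬ Refuted r s' := fun s' hs' href =>
      absurd (le_of_refuted hc href hd) (by omega)
    have hmem := guess_mem_of_forall_not_refuted hstable
    have h₀ : ∀ n, Ψ (pair x s) (2 * n) = guess r (s 0 + 1) := by
      intro n
      have h₁ : (fun i => pair x s (4 * i)) = r := by
        funext i
        have h : 4 * i / 2 = 2 * i := by omega
        have h' : 4 * i % 2 = 0 := by omega
        simp [pair, h, h', hr]
      have h₂ : pair x s 1 = s 0 := by simp [pair]
      simp [Ψ, h₁, h₂]
    have h₁ : ∀ n, Ψ (pair x s) (2 * n + 1) = 1 := by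
      intro n
      simp [Ψ]
    refine ⟨Ψ (pair x s), ?_, (guess r (s 0 + 1), ⟨1, rfl⟩), ?_, hmem, rfl⟩
    · exact Part.mem_bind (Part.mem_some _) (Part.mem_bind hs (Part.mem_some _))
    · exact ⟨⟨trivial, trivial, h₁ 0⟩, Prod.ext (h₀ 0) (Subtype.ext (h₁ 0))⟩

end Weihrauch

theorem proposition15 (M : List Bool →. List Bool) (hM : IsUniversalPrefixFreeMachine M) :
    (∀ p : MLR, (Kol M p).Nonempty) ∧
      Weihrauch.Equivalent (Kol M)
        (Weihrauch.multiProd closedChoiceNat (constOn (toBaire '' MLR))) :=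
  ⟨Kol_nonempty hM.1, reducible_Kol hM.1, Kol_reducible hM⟩
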